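/- Let $D_1,D_2,\dots$ be i.i.d. data with law $P$, and let $g(D,\gamma)\in\mathbb R^L$ be estimating functions with parameter $\gamma\in\mathbb R^p$ ($p$, $L$ fixed), measurable in $D$. Suppose that the model is correctly specified with true parameter $\gamma_0$ and that the following regularity condition holds: $E\{g(D,\gamma_0)\}=0$; the matrix $\Sigma_{11}=E\{g(D,\gamma_0)g(D,\gamma_0)^{T}\}$ is positive definite; and there is a neighbourhood of $\gamma_0$ on which, for $P$-almost every $D$, the second derivative $\partial^2 g(D,\gamma)/\partial\gamma\,\partial\gamma^T$ exists and is continuous in $\gamma$ and $\|\partial g(D,\gamma)/\partial\gamma^T\|$, $\|\partial^2 g(D,\gamma)/\partial\gamma\,\partial\gamma^T\|$ and $\|g(D,\gamma)\|^3$ are all bounded by a $P$-integrable function of $D$ that does not depend on $\gamma$. Put $\Sigma_{12}=E\{\partial g(D,\gamma_0)/\partial\gamma^T\}$. Let $\hat\gamma_{EE}=\hat\gamma_{EE,n}$ be any plug-in estimators with $\hat\gamma_{EE}-\gamma_0=O_p(n^{-1/2})$, and let $$l=-\log\sup\Big\{\prod_{i=1}^n np_i\;:\;p_i\ge 0,\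 \sum_{i=1}^n p_i=1,\ \sum_{i=1}^n p_i\,g(D_i,\hat\gamma_{EE})=0\Big\}$$ be the negative log empirical likelihood ratio at $\hat\gamma_{EE}$ (with $\sup\emptyset=0$ and $-\log 0=+\infty$). Then, with probability tending to one as $n\to\infty$, the equation $\frac1n\sum_{i=1}^n \frac{g(D_i,\hat\gamma_{EE})}{1+\lambda^Tg(D_i,\hat\gamma_{EE})}=0$ has exactly one solution $\hat\lambda_{EE}$ in the set of $\lambda\in\mathbb R^L$ with $1+\lambda^Tg(D_i,\hat\gamma_{EE})>0$ for all $i\le n$, and $l=\sum_{i=1}^n\log\{1+\hat\lambda_{EE}^Tg(D_i,\hat\gamma_{EE})\}$. Moreover, with $Q_n=\frac1n\sum_{i=1}^n g(D_i,\gamma_0)+\Sigma_{12}(\hat\gamma_{EE}-\gamma_0)$, $$l=\tfrac12\,(\sqrt n\,Q_n)^T\,\Sigma_{11}^{-1}\,(\sqrt n\,Q_n)+o_p(1).$$ -/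

import Mathlib

open MeasureTheory ProbabilityTheory Filter Topology
open scoped ENNReal Matrix

noncomputable section

/-- The empirical likelihood ratio of the vectors `x 0, …, x (n-1)`: the supremum of `∏ n pᵢ` over
the weights with `pᵢ ≥ 0`, `∑ pᵢ = 1` and `∑ pᵢ xᵢ = 0`. It is `0` if there are no such weights. -/
def empLikRatio {L n : ℕ} (x : Fin n → EuclideanSpace ℝ (Fin L)) : ℝ≥0∞ :=
  ⨆ (p : Fin n → ℝ) (_ : (∀ i, 0 ≤ p i) ∧ ∑ i, p i = 1 ∧ ∑ i, p i • x i = 0),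
    ENNReal.ofReal (∏ i, ((n : ℝ) * p i))

/-- The negative logarithm of the empirical likelihood ratio, with `-log 0 = ∞`. -/
def negLogEmpLik {L n : ℕ} (x : Fin n → EuclideanSpace ℝ (Fin L)) : EReal :=
  -ENNReal.log (empLikRatio x)

/-- `lam` is a Lagrange multiplier for the vectors `x i`: all `1 + lamᵀ xᵢ` are positive and
`(1/n) ∑ xᵢ / (1 + lamᵀ xᵢ) = 0`. -/
def IsLagrangeMultiplier {L n : ℕ} (x : Fin n → EuclideanSpace ℝ (Fin L))
    (lam : EuclideanSpace ℝ (Fin L)) : Prop :=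
  (∀ i, 0 < 1 + inner ℝ lam (x i)) ∧
    (n : ℝ)⁻¹ • ∑ i, (1 + inner ℝ lam (x i))⁻¹ • x i = 0

section Model

variable {𝓓 : Type*} [MeasurableSpace 𝓓] {p L : ℕ}

/-- `Σ₁₁ = E[g(D, γ₀) g(D, γ₀)ᵀ]` for `D` with law `P`. -/
def Sigma11 (P : Measure 𝓓) (g : 𝓓 → EuclideanSpace ℝ (Fin p) → EuclideanSpace ℝ (Fin L))
    (γ₀ : EuclideanSpace ℝ (Fin p)) : Matrix (Fin L) (Fin L) ℝ :=
  Matrix.of fun j k => ∫ d, g d γ₀ j * g d γ₀ k ∂P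

/-- `Σ₁₂ = E[∂g(D, γ₀)/∂γᵀ]` for `D` with law `P`: the expected Jacobian matrix. -/
def Sigma12 (P : Measure 𝓓) (g : 𝓓 → EuclideanSpace ℝ (Fin p) → EuclideanSpace ℝ (Fin L))
    (γ₀ : EuclideanSpace ℝ (Fin p)) : Matrix (Fin L) (Fin p) ℝ :=
  Matrix.of fun j k => ∫ d, (fderiv ℝ (g d) γ₀ (EuclideanSpace.single k 1)) j ∂P

/-- The regularity condition, for a correctly specified model with true parameter `γ₀`.
Integrability of `g(D, γ₀)`, of the entries of `g gᵀ` and of the Jacobian at `γ₀` is implied by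
measurability and the domination. -/
structure Regularity (P : Measure 𝓓)
    (g : 𝓓 → EuclideanSpace ℝ (Fin p) → EuclideanSpace ℝ (Fin L))
    (γ₀ : EuclideanSpace ℝ (Fin p)) : Prop where
  measurable : ∀ γ, Measurable fun d => g d γ
  mean_zero : ∫ d, g d γ₀ ∂P = 0
  posDef : (Sigma11 P g γ₀).PosDef
  smooth_dominated : ∃ U : Set (EuclideanSpace ℝ (Fin p)), IsOpen U ∧ γ₀ ∈ U ∧
    (∀ᵐ d ∂P, ContDiffOn ℝ 2 (g d) U) ∧
    ∃ G : 𝓓 → ℝ, Integrable G P ∧ ∀ᵐ d ∂P, ∀ γ ∈ U,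
      ‖fderiv ℝ (g d) γ‖ ≤ G d ∧ ‖iteratedFDeriv ℝ 2 (g d) γ‖ ≤ G d ∧ ‖g d γ‖ ^ 3 ≤ G d

/-- `Q = (1/n) ∑ᵢ g(Dᵢ, γ₀) + Σ₁₂ (γ - γ₀)` for data `D₀, …, Dₙ₋₁` and an estimate `γ`. -/
def Qvec (P : Measure 𝓓) (g : 𝓓 → EuclideanSpace ℝ (Fin p) → EuclideanSpace ℝ (Fin L))
    (γ₀ : EuclideanSpace ℝ (Fin p)) {n : ℕ} (data : Fin n → 𝓓)
    (γ : EuclideanSpace ℝ (Fin p)) : Fin L → ℝ :=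
  fun j => (n : ℝ)⁻¹ * ∑ i, g (data i) γ₀ j + (Sigma12 P g γ₀ *ᵥ fun k => γ k - γ₀ k) j

end Model

/-- `X n = O_p(a n)`: for every `ε > 0` there is `M` such that `P(‖X n‖ > M a n) ≤ ε` for all
large `n`. -/
def IsBigOInProb {Ω E : Type*} [MeasurableSpace Ω] [Norm E] (μ : Measure Ω) (X : ℕ → Ω → E)
    (a : ℕ → ℝ) : Prop :=
  ∀ ε : ℝ≥0∞, 0 < ε → ∃ M : ℝ, ∀ᶠ n in atTop, μ {ω | M * a n < ‖X n ω‖} ≤ ε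

/-- `X n = o_p(1)` for extended real `X n`: for every `ε > 0`, `P(|X n| ≥ ε) → 0`. -/
def IsLittleOOneInProb {Ω : Type*} [MeasurableSpace Ω] (μ : Measure Ω)
    (X : ℕ → Ω → EReal) : Prop :=
  ∀ ε : ℝ, 0 < ε → Tendsto (fun n => μ {ω | ENNReal.ofReal ε ≤ (X n ω).abs}) atTop (𝓝 0)

end

/-!
For a fixed sample write `xᵢ = g(Dᵢ, γ̂)` and `yᵢ = xᵢ / √n`. The optimization over the weights is
dual to the maximization of the concave function `F(v) = ∑ log (1 + ⟨v, yᵢ⟩)`: a critical point `v`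
gives the multiplier `λ = v / √n` and the weights `pᵢ = 1 / (n (1 + λᵀ xᵢ))`, which are optimal by
the inequality of the geometric and the arithmetic mean (`IsLagrangeMultiplier.negLogEmpLik_eq`), so
that the negative log empirical likelihood ratio is `F(v)`.

On a fixed ball `‖v‖ ≤ K` the logarithm is expanded to second order. If `∑ ‖yᵢ‖³` is small, `∑ yᵢ`
is close to `q` and `∑ yᵢ yᵢᵀ` is close to `Σ₁₁`, then `F` is uniformly close to the quadratic
function `⟨v, q⟩ - ⟨v, Σ₁₁ v⟩ / 2`. The latter is negative on the sphere if `K` is large, while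
`F(0) = 0`, so `F` has an interior maximum; and as the two functions are uniformly close, so are
their maxima, that of the quadratic function being `⟨q, Σ₁₁⁻¹ q⟩ / 2`. This is
`exists_critical_point`. The expansion thus follows without an expansion of the multiplier itself.

With `q = √n Q`, these hypotheses hold on samples that are typical in the sense of `TypicalSample`
(`expansion_of_typicalSample`). There `∑ ‖yᵢ‖³ ≤ n^{-3/2} ∑ G(Dᵢ) = O(n^{-1/2})`, which also bounds
every `‖yᵢ‖`; a Taylor expansion of `g` at `γ₀` with the dominated second derivative turns `∑ yᵢ`
into `√n Q`; and the dominated first derivative lets `γ₀` replace `γ̂` in `∑ yᵢ yᵢᵀ`.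
Samples are typical with probability close to one (`exists_measure_not_typicalSample_le`) by the law
of large numbers for `G`, the Jacobian and `g gᵀ`, and by Chebyshev's inequality for `∑ g(Dᵢ, γ₀)`.
-/

/-! ### Maximizing `∑ log (1 + ⟨v, yᵢ⟩)` -/

section LogSum

variable {ι E : Type*} [Fintype ι] [NormedAddCommGroup E] [InnerProductSpace ℝ E]

/-- The dual objective `v ↦ ∑ᵢ log (1 + ⟨v, yᵢ⟩)` of the empirical likelihood problem. It is used
only where all the arguments of the logarithm are positive. -/
noncomputable def logSum (y : ι → E) (v : E) : ℝ :=
  ∑ i, Real.log (1 + inner ℝ v (y i))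

lemma abs_log_one_add_sub_le {t : ℝ} (ht : |t| ≤ 1 / 2) :
    |Real.log (1 + t) - (t - t ^ 2 / 2)| ≤ 2 * |t| ^ 3 := by
  have h := Real.abs_log_sub_add_sum_range_le (x := -t) (by rw [abs_neg]; linarith) 2
  norm_num [Finset.sum_range_succ] at h
  have e : Real.log (1 + t) - (t - t ^ 2 / 2) = -t + t ^ 2 / 2 + Real.log (1 + t) := by ring
  rw [e]
  refine h.trans ?_
  rw [div_le_iff₀ (by linarith)]
  nlinarith [pow_nonneg (abs_nonneg t) 3]

lemma abs_inner_le_half {y : ι → E} {v : E} {K η : ℝ} (hK : 0 ≤ K) (hv : ‖v‖ ≤ K)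
    (hKη : K ^ 3 * η ≤ 1 / 8) (h3 : ∑ i, ‖y i‖ ^ 3 ≤ η) (i : ι) :
    |inner ℝ v (y i)| ≤ 1 / 2 := by
  have h1 : ‖y i‖ ^ 3 ≤ η :=
    (Finset.single_le_sum (f := fun i => ‖y i‖ ^ 3) (fun _ _ => by positivity)
      (Finset.mem_univ i)).trans h3
  have h2 : (K * ‖y i‖) ^ 3 ≤ (1 / 2) ^ 3 := by
    rw [mul_pow]
    calc K ^ 3 * ‖y i‖ ^ 3 ≤ K ^ 3 * η := by gcongr
      _ ≤ _ := by linarith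
  have h4 : K * ‖y i‖ ≤ 1 / 2 := le_of_pow_le_pow_left₀ (by norm_num) (by norm_num) h2
  refine (abs_real_inner_le_norm _ _).trans (le_trans ?_ h4)
  gcongr

/-- Quadratic approximation of the dual objective, uniformly on the ball of radius `K`. -/
lemma abs_logSum_sub_le {y : ι → E} {v q : E} {T : E →ₗ[ℝ] E} {K η : ℝ} (hK : 0 ≤ K)
    (hv : ‖v‖ ≤ K) (hKη : K ^ 3 * η ≤ 1 / 8) (h3 : ∑ i, ‖y i‖ ^ 3 ≤ η)
    (h1 : ‖∑ i, y i - q‖ ≤ η)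
    (h2 : ∀ u, |∑ i, inner ℝ u (y i) ^ 2 - inner ℝ u (T u)| ≤ η * ‖u‖ ^ 2) :
    |logSum y v - (inner ℝ v q - inner ℝ v (T v) / 2)| ≤ η * (K + K ^ 2 / 2 + 2 * K ^ 3) := by
  have hη : 0 ≤ η := (norm_nonneg _).trans h1
  have a1 : |∑ i, (Real.log (1 + inner ℝ v (y i)) -
      (inner ℝ v (y i) - inner ℝ v (y i) ^ 2 / 2))| ≤ 2 * K ^ 3 * η := by
    calc _ ≤ ∑ i, 2 * (K * ‖y i‖) ^ 3 := by
          refine (Finset.abs_sum_le_sum_abs _ _).trans (Finset.sum_le_sum fun i _ => ?_)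
          refine (abs_log_one_add_sub_le (abs_inner_le_half hK hv hKη h3 i)).trans ?_
          gcongr
          exact (abs_real_inner_le_norm _ _).trans (by gcongr)
      _ = 2 * K ^ 3 * ∑ i, ‖y i‖ ^ 3 := by
          rw [Finset.mul_sum]; exact Finset.sum_congr rfl fun i _ => by ring
      _ ≤ _ := by gcongr
  have a2 : |inner ℝ v (∑ i, y i - q)| ≤ K * η :=
    (abs_real_inner_le_norm _ _).trans (by gcongr)
  have a3 : |∑ i, inner ℝ v (y i) ^ 2 - inner ℝ v (T v)| ≤ η * K ^ 2 :=
    (h2 v).trans (by gcongr)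
  rw [Finset.sum_sub_distrib, Finset.sum_sub_distrib, ← Finset.sum_div, ← inner_sum] at a1
  rw [inner_sub_right] at a2
  rw [abs_le] at a1 a2 a3 ⊢
  unfold logSum
  constructor <;> linarith [a1.1, a1.2, a2.1, a2.2, a3.1, a3.2]

lemma hasFDerivAt_logSum {y : ι → E} {v : E} (hv : ∀ i, 0 < 1 + inner ℝ v (y i)) :
    HasFDerivAt (logSum y)
      (∑ i, (1 + inner ℝ v (y i))⁻¹ • (innerSL ℝ (y i))) v := by
  unfold logSum
  refine HasFDerivAt.fun_sum fun i _ => ?_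
  refine HasFDerivAt.log ?_ (hv i).ne'
  exact HasFDerivAt.const_add _ ((innerSL ℝ (y i)).hasFDerivAt.congr_of_eventuallyEq
    (Eventually.of_forall fun w => real_inner_comm _ _))

/-- Completing the square: the quadratic form `⟨v, q⟩ - ⟨v, T v⟩ / 2` is maximal at the solution
`w` of `T w = q`. -/
lemma inner_sub_half_inner_le {T : E →ₗ[ℝ] E} (hT : T.IsSymmetric)
    (hpos : ∀ u, 0 ≤ inner ℝ u (T u)) {q w : E} (hw : T w = q) (v : E) :
    inner ℝ v q - inner ℝ v (T v) / 2 ≤ inner ℝ q w / 2 := by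
  have h := hpos (w - v)
  have hs : inner ℝ w (T v) = inner ℝ v q := by rw [← hT, hw, real_inner_comm]
  rw [map_sub, inner_sub_left, inner_sub_right, inner_sub_right, hs, hw] at h
  rw [real_inner_comm w q]
  linarith

/-- If the `yᵢ` are small, `∑ yᵢ` is close to `q` and `∑ yᵢ yᵢᵀ` is close to the positive definite
`T`, then the dual objective has a critical point, its value there is close to `⟨q, T⁻¹ q⟩ / 2`, and
the `yᵢ` span the space. -/
lemma exists_critical_point [FiniteDimensional ℝ E] {T : E →ₗ[ℝ] E} (hT : T.IsSymmetric)
    {c : ℝ} (hc : 0 < c) (hTc : ∀ u, c * ‖u‖ ^ 2 ≤ inner ℝ u (T u)) {M : ℝ} (hM : 0 ≤ M)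
    {ε : ℝ} (hε : 0 < ε) :
    ∃ η : ℝ, 0 < η ∧ ∀ {ι : Type} [Fintype ι] (y : ι → E) (q w : E), T w = q → ‖q‖ ≤ M →
      ∑ i, ‖y i‖ ^ 3 ≤ η → ‖∑ i, y i - q‖ ≤ η →
      (∀ u, |∑ i, inner ℝ u (y i) ^ 2 - inner ℝ u (T u)| ≤ η * ‖u‖ ^ 2) →
      (∀ u, (∀ i, inner ℝ u (y i) = 0) → u = 0) ∧
      ∃ v, (∀ i, 0 < 1 + inner ℝ v (y i)) ∧ ∑ i, (1 + inner ℝ v (y i))⁻¹ • y i = 0 ∧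
        |logSum y v - inner ℝ q w / 2| < ε := by
  -- On the sphere of radius `K` the quadratic approximation is at most `K M - c K² / 2 = -K`.
  obtain ⟨K, hKdef⟩ : ∃ K, K = 2 * (M + 1) / c := ⟨_, rfl⟩
  have hK : 0 < K := by rw [hKdef]; positivity
  have hcK : c * K = 2 * (M + 1) := by rw [hKdef]; field_simp
  obtain ⟨C, hCdef⟩ : ∃ C, C = K + K ^ 2 / 2 + 2 * K ^ 3 := ⟨_, rfl⟩
  have hC : 0 < C := by rw [hCdef]; positivity
  obtain ⟨η, hη, hη1⟩ : ∃ η : ℝ, 0 < η ∧ η < min (min (1 / 8 / K ^ 3) c) (min (K / C) (ε / C)) :=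
    exists_between (by positivity)
  rw [lt_min_iff, lt_min_iff, lt_min_iff, lt_div_iff₀ hC, lt_div_iff₀ hC,
    lt_div_iff₀ (by positivity)] at hη1
  obtain ⟨⟨hη1, hη2⟩, hη3, hη4⟩ := hη1
  have hKη : K ^ 3 * η ≤ 1 / 8 := by rw [mul_comm]; exact hη1.le
  refine ⟨η, hη, ?_⟩
  intro ι _ y q w hw hq h3 h1 h2
  have happ : ∀ v, ‖v‖ ≤ K → |logSum y v - (inner ℝ v q - inner ℝ v (T v) / 2)| ≤ η * C :=
    fun v hv => by rw [hCdef]; exact abs_logSum_sub_le hK.le hv hKη h3 h1 h2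
  have hpos : ∀ v, ‖v‖ ≤ K → ∀ i, 0 < 1 + inner ℝ v (y i) := fun v hv i => by
    linarith [(abs_le.1 (abs_inner_le_half hK.le hv hKη h3 i)).1]
  constructor
  · intro u hu
    have h := h2 u
    simp only [hu] at h
    have h' := (abs_le.1 h).1
    simp only [ne_eq, OfNat.ofNat_ne_zero, not_false_eq_true, zero_pow, Finset.sum_const_zero,
      zero_sub] at h'
    have := hTc u
    have h0 : ‖u‖ ^ 2 = 0 := by
      by_contra hne
      have : 0 < ‖u‖ ^ 2 := lt_of_le_of_ne (by positivity) (Ne.symm hne)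
      nlinarith
    simpa using h0
  obtain ⟨v, hvK, hvmax⟩ := (isCompact_closedBall (0 : E) K).exists_isMaxOn
    ⟨0, by simp [hK.le]⟩ (f := logSum y) (fun v hv =>
      (hasFDerivAt_logSum (hpos v (by simpa using hv))).continuousAt.continuousWithinAt)
  replace hvK : ‖v‖ ≤ K := by simpa using hvK
  have hmax : ∀ v', ‖v'‖ ≤ K → logSum y v' ≤ logSum y v := fun v' hv' =>
    hvmax (by simpa using hv')
  have hv0 : 0 ≤ logSum y v := by
    have := hmax 0 (by simp [hK.le])
    simpa [logSum] using this
  have hvlt : ‖v‖ < K := by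
    refine lt_of_le_of_ne hvK fun hEq => ?_
    have h4 := (abs_le.1 (happ v hvK)).2
    have h5 := hTc v
    have h6 : inner ℝ v q ≤ K * M := (real_inner_le_norm _ _).trans (by rw [hEq]; gcongr)
    rw [hEq] at h5
    have h7 : c * K ^ 2 = 2 * (M + 1) * K := by rw [← hcK]; ring
    linarith
  have hpos' : ∀ u, 0 ≤ inner ℝ u (T u) := fun u => le_trans (by positivity) (hTc u)
  have hwK : ‖w‖ ≤ K := by
    have h4 := hTc w
    have h5 : inner ℝ w (T w) ≤ ‖w‖ * M := by
      rw [hw]; exact (real_inner_le_norm _ _).trans (by gcongr)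
    by_contra! hlt
    have h6 : c * K < c * ‖w‖ := by gcongr
    have h7 : 0 < ‖w‖ := hK.trans hlt
    nlinarith
  refine ⟨v, hpos v hvK, ?_, ?_⟩
  · have hloc : IsLocalMax (logSum y) v := by
      filter_upwards [Metric.isOpen_ball.mem_nhds (show v ∈ Metric.ball (0 : E) K by simpa)]
        with v' hv'
      exact hmax v' (le_of_lt (by simpa using hv'))
    have h := hloc.hasFDerivAt_eq_zero (hasFDerivAt_logSum (hpos v hvK))
    refine ext_inner_right ℝ fun u => ?_
    have h' := congrArg (fun φ => φ u) h
    simpa [sum_inner, inner_smul_left] using h'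
  · have h4 := (abs_le.1 (happ v hvK)).2
    have h5 := (abs_le.1 (happ w hwK)).1
    have h6 := hmax w hwK
    have h7 := inner_sub_half_inner_le hT hpos' hw v
    rw [hw, real_inner_comm q w] at h5
    rw [abs_lt]
    constructor <;> linarith

end LogSum

/-! ### Duality -/

section Duality

variable {L n : ℕ} {x : Fin n → EuclideanSpace ℝ (Fin L)} {lam lam' : EuclideanSpace ℝ (Fin L)}

/-- The weights `pᵢ = 1 / (n (1 + lamᵀ xᵢ))` given by a multiplier are feasible, and by the
inequality between the geometric and the arithmetic mean no others do better. -/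
lemma IsLagrangeMultiplier.empLikRatio_eq (hn : n ≠ 0) (h : IsLagrangeMultiplier x lam) :
    empLikRatio x = ENNReal.ofReal (∏ i, (1 + inner ℝ lam (x i))⁻¹) := by
  obtain ⟨hpos, hsum⟩ := h
  have hn' : (0 : ℝ) < n := by positivity
  have hsum0 : ∑ i, (1 + inner ℝ lam (x i))⁻¹ • x i = 0 :=
    (smul_eq_zero.1 hsum).resolve_left (inv_ne_zero hn'.ne')
  apply le_antisymm
  · refine iSup₂_le fun p ⟨hp0, hp1, hpx⟩ => ENNReal.ofReal_le_ofReal ?_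
    rw [Finset.prod_inv_distrib, ← one_div, le_div_iff₀ (Finset.prod_pos fun i _ => hpos i),
      ← Finset.prod_mul_distrib]
    set z : Fin n → ℝ := fun i => n * p i * (1 + inner ℝ lam (x i)) with hz
    have hz0 : ∀ i, 0 ≤ z i := fun i =>
      mul_nonneg (mul_nonneg hn'.le (hp0 i)) (hpos i).le
    have hamgm := Real.geom_mean_le_arith_mean_weighted Finset.univ (fun _ : Fin n => (n : ℝ)⁻¹) z
      (fun _ _ => by positivity) (by simp [hn]) (fun i _ => hz0 i)
    have h1 : ∑ i, (n : ℝ)⁻¹ * z i = 1 := by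
      have : ∀ i, (n : ℝ)⁻¹ * z i = p i + inner ℝ lam (p i • x i) := fun i => by
        rw [hz, inner_smul_right]; field_simp
      rw [Finset.sum_congr rfl fun i _ => this i, Finset.sum_add_distrib, ← inner_sum, hpx, hp1]
      simp
    rw [h1, Real.finsetProd_rpow _ _ (fun i _ => hz0 i)] at hamgm
    have h2 := pow_le_one₀ (n := n) (Real.rpow_nonneg (Finset.prod_nonneg fun i _ => hz0 i) _) hamgm
    rwa [← Real.rpow_natCast, ← Real.rpow_mul (Finset.prod_nonneg fun i _ => hz0 i),
      inv_mul_cancel₀ hn'.ne', Real.rpow_one] at h2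
  · have hfeas : (∀ i, 0 ≤ (n : ℝ)⁻¹ * (1 + inner ℝ lam (x i))⁻¹) ∧
        ∑ i, (n : ℝ)⁻¹ * (1 + inner ℝ lam (x i))⁻¹ = 1 ∧
        ∑ i, ((n : ℝ)⁻¹ * (1 + inner ℝ lam (x i))⁻¹) • x i = 0 := by
      refine ⟨fun i => mul_nonneg (by positivity) (inv_nonneg.2 (hpos i).le), ?_, ?_⟩
      · have h1 : ∑ i, (1 + inner ℝ lam (x i))⁻¹ = n := by
          have : ∀ i, (1 + inner ℝ lam (x i))⁻¹ =
              1 - inner ℝ lam ((1 + inner ℝ lam (x i))⁻¹ • x i) := fun i => by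
            have := (hpos i).ne'
            rw [inner_smul_right]; field_simp; ring
          rw [Finset.sum_congr rfl fun i _ => this i, Finset.sum_sub_distrib, ← inner_sum, hsum0]
          simp
        rw [← Finset.mul_sum, h1, inv_mul_cancel₀ hn'.ne']
      · simpa only [Finset.smul_sum, smul_smul] using hsum
    refine le_trans (le_of_eq ?_) (le_iSup₂_of_le _ hfeas le_rfl)
    congr 1
    refine Finset.prod_congr rfl fun i _ => ?_
    rw [← mul_assoc, mul_inv_cancel₀ hn'.ne', one_mul]

lemma IsLagrangeMultiplier.negLogEmpLik_eq (hn : n ≠ 0) (h : IsLagrangeMultiplier x lam) :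
    negLogEmpLik x = (logSum x lam : ℝ) := by
  have hp : 0 < ∏ i, (1 + inner ℝ lam (x i))⁻¹ :=
    Finset.prod_pos fun i _ => inv_pos.2 (h.1 i)
  rw [negLogEmpLik, h.empLikRatio_eq hn, ENNReal.log_ofReal_of_pos hp, ← EReal.coe_neg,
    Finset.prod_inv_distrib, Real.log_inv, neg_neg, Real.log_prod fun i _ => (h.1 i).ne']
  rfl

/-- Multipliers are unique if the `xᵢ` span the space, by strict monotonicity of `t ↦ -1/(1+t)`. -/
lemma IsLagrangeMultiplier.unique (hn : n ≠ 0) (hx : ∀ u, (∀ i, inner ℝ u (x i) = 0) → u = 0)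
    (h : IsLagrangeMultiplier x lam) (h' : IsLagrangeMultiplier x lam') : lam' = lam := by
  have hn' : (n : ℝ)⁻¹ ≠ 0 := by positivity
  have e1 := (smul_eq_zero.1 h.2).resolve_left hn'
  have e2 := (smul_eq_zero.1 h'.2).resolve_left hn'
  rw [← sub_eq_zero]
  have key : ∑ i, inner ℝ (lam' - lam) (x i) ^ 2 *
      ((1 + inner ℝ lam (x i))⁻¹ * (1 + inner ℝ lam' (x i))⁻¹) = 0 := by
    have : inner ℝ (lam' - lam) (∑ i, (1 + inner ℝ lam (x i))⁻¹ • x i -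
        ∑ i, (1 + inner ℝ lam' (x i))⁻¹ • x i) = 0 := by simp [e1, e2]
    rw [← this, ← Finset.sum_sub_distrib, inner_sum]
    refine Finset.sum_congr rfl fun i _ => ?_
    have := (h.1 i).ne'
    have := (h'.1 i).ne'
    simp only [inner_sub_right, inner_smul_right, inner_sub_left]
    field_simp
    ring
  refine hx _ fun i => ?_
  have hp : ∀ i, 0 < (1 + inner ℝ lam (x i))⁻¹ * (1 + inner ℝ lam' (x i))⁻¹ := fun i =>
    mul_pos (inv_pos.2 (h.1 i)) (inv_pos.2 (h'.1 i))
  have := (Finset.sum_eq_zero_iff_of_nonneg fun i _ =>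
    mul_nonneg (sq_nonneg (inner ℝ (lam' - lam) (x i))) (hp i).le).1 key i (Finset.mem_univ i)
  exact pow_eq_zero_iff two_ne_zero |>.1 ((mul_eq_zero.1 this).resolve_right (hp i).ne')

end Duality

/-! ### Taylor bounds for the estimating function -/

section Taylor

variable {E F : Type*} [NormedAddCommGroup E] [NormedSpace ℝ E] [NormedAddCommGroup F]
  [NormedSpace ℝ F] {f : E → F} {U : Set E} {a b : E} {ρ C : ℝ}

lemma norm_sub_le_of_contDiffOn (hU : IsOpen U) (hf : ContDiffOn ℝ 2 f U)
    (hρ : Metric.ball a ρ ⊆ U) (h1 : ∀ x ∈ U, ‖fderiv ℝ f x‖ ≤ C) (hb : b ∈ Metric.ball a ρ) :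
    ‖f b - f a‖ ≤ C * ‖b - a‖ := by
  have ha : a ∈ Metric.ball a ρ := Metric.mem_ball_self (dist_nonneg.trans_lt hb)
  exact (convex_ball a ρ).norm_image_sub_le_of_norm_fderiv_le
    (fun x hx => ((hf.contDiffAt (hU.mem_nhds (hρ hx))).differentiableAt (by norm_num)))
    (fun x hx => h1 x (hρ hx)) ha hb

lemma norm_sub_sub_fderiv_le_of_contDiffOn (hU : IsOpen U) (hf : ContDiffOn ℝ 2 f U)
    (hρ : Metric.ball a ρ ⊆ U) (h2 : ∀ x ∈ U, ‖iteratedFDeriv ℝ 2 f x‖ ≤ C)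
    (hb : b ∈ Metric.ball a ρ) :
    ‖f b - f a - fderiv ℝ f a (b - a)‖ ≤ C * ‖b - a‖ ^ 2 := by
  have ha : a ∈ Metric.ball a ρ := Metric.mem_ball_self (dist_nonneg.trans_lt hb)
  have hC : 0 ≤ C := (norm_nonneg _).trans (h2 a (hρ ha))
  have hcd : ∀ x ∈ Metric.ball a ρ, ContDiffAt ℝ 2 f x := fun x hx =>
    hf.contDiffAt (hU.mem_nhds (hρ hx))
  have hd : ∀ x ∈ Metric.ball a ρ, ‖fderiv ℝ f x - fderiv ℝ f a‖ ≤ C * ‖x - a‖ := fun x hx => by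
    refine (convex_ball a ρ).norm_image_sub_le_of_norm_fderiv_le (𝕜 := ℝ)
      (fun y hy => ((hcd y hy).fderiv_right (m := 1) (by norm_num)).differentiableAt (by norm_num))
      (fun y hy => ?_) ha hx
    rw [← norm_iteratedFDeriv_one, norm_iteratedFDeriv_fderiv]
    exact h2 y (hρ hy)
  -- On the segment from `a` to `b` the derivative is within `C ‖b - a‖` of the one at `a`.
  have hseg : segment ℝ a b ⊆ Metric.ball a ρ := (convex_ball a ρ).segment_subset ha hb
  have := (convex_segment a b).norm_image_sub_le_of_norm_fderiv_le' (𝕜 := ℝ) (f := f)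
    (φ := fderiv ℝ f a) (C := C * ‖b - a‖)
    (fun x hx => (hcd x (hseg hx)).differentiableAt (by norm_num))
    (fun x hx => (hd x (hseg hx)).trans (by
      gcongr
      exact norm_sub_le_of_mem_segment hx))
    (left_mem_segment ℝ a b) (right_mem_segment ℝ a b)
  calc _ ≤ C * ‖b - a‖ * ‖b - a‖ := this
    _ = _ := by ring

end Taylor

/-! ### Coordinate bounds -/

section Coordinates

variable {L : ℕ}

lemma norm_le_sum_abs_apply (v : EuclideanSpace ℝ (Fin L)) : ‖v‖ ≤ ∑ j, |v j| := by
  rw [EuclideanSpace.norm_eq]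
  refine Real.sqrt_le_iff.2 ⟨by positivity, ?_⟩
  simpa using Finset.sum_sq_le_sq_sum_of_nonneg (s := Finset.univ) (f := fun j => |v j|)
    (fun _ _ => abs_nonneg _)

lemma abs_apply_le_norm (v : EuclideanSpace ℝ (Fin L)) (j : Fin L) : |v j| ≤ ‖v‖ :=
  PiLp.norm_apply_le v j

lemma inner_toEuclideanLin (A : Matrix (Fin L) (Fin L) ℝ) (u : EuclideanSpace ℝ (Fin L)) :
    inner ℝ u (Matrix.toEuclideanLin A u) = ∑ j, ∑ k, u j * u k * A j k := by
  simp only [PiLp.inner_apply, Matrix.toLpLin_apply, Matrix.mulVec, dotProduct]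
  refine Finset.sum_congr rfl fun j _ => ?_
  simp only [RCLike.inner_apply, conj_trivial, Finset.sum_mul]
  exact Finset.sum_congr rfl fun k _ => by ring

/-- A positive definite matrix is coercive, by compactness of the unit sphere. -/
lemma Matrix.PosDef.exists_coercive {A : Matrix (Fin L) (Fin L) ℝ} (hA : A.PosDef) :
    ∃ c : ℝ, 0 < c ∧ ∀ u : EuclideanSpace ℝ (Fin L),
      c * ‖u‖ ^ 2 ≤ inner ℝ u (Matrix.toEuclideanLin A u) := by
  have hpos : ∀ u : EuclideanSpace ℝ (Fin L), u ≠ 0 →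
      0 < inner ℝ u (Matrix.toEuclideanLin A u) := fun u hu => by
    have h := hA.dotProduct_mulVec_pos (x := u.ofLp) (fun h => hu (by ext j; simp [h]))
    rw [inner_toEuclideanLin]
    simpa [Matrix.mulVec, dotProduct, Finset.mul_sum, mul_assoc, mul_comm, mul_left_comm] using h
  have hcont : Continuous fun u : EuclideanSpace ℝ (Fin L) =>
      inner ℝ u (Matrix.toEuclideanLin A u) :=
    continuous_id.inner (LinearMap.continuous_of_finiteDimensional _)
  rcases (Metric.sphere (0 : EuclideanSpace ℝ (Fin L)) 1).eq_empty_or_nonempty with he | hne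
  · refine ⟨1, one_pos, fun u => ?_⟩
    have : u = 0 := by
      by_contra hu
      have : ‖u‖⁻¹ • u ∈ Metric.sphere (0 : EuclideanSpace ℝ (Fin L)) 1 := by
        simp [norm_smul, hu]
      rw [he] at this
      exact this
    simp [this]
  obtain ⟨u₀, hu₀, hmin⟩ := (isCompact_sphere (0 : EuclideanSpace ℝ (Fin L)) 1).exists_isMinOn
    hne hcont.continuousOn
  have hu₀' : u₀ ≠ 0 := by rintro rfl; simp at hu₀
  refine ⟨_, hpos u₀ hu₀', fun u => ?_⟩
  rcases eq_or_ne u 0 with rfl | hu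
  · simp
  have hm : ‖u‖⁻¹ • u ∈ Metric.sphere (0 : EuclideanSpace ℝ (Fin L)) 1 := by
    simp [norm_smul, hu]
  have h := hmin hm
  simp only [Set.mem_ofPred_eq, map_smul, inner_smul_left, inner_smul_right, conj_trivial] at h
  have hn : 0 < ‖u‖ := norm_pos_iff.2 hu
  calc _ ≤ ‖u‖⁻¹ * (‖u‖⁻¹ * inner ℝ u (Matrix.toEuclideanLin A u)) * ‖u‖ ^ 2 := by gcongr
    _ = _ := by field_simp

lemma abs_sum_sq_inner_sub_le {ι : Type*} [Fintype ι] {y z : ι → EuclideanSpace ℝ (Fin L)}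
    {τ : ℝ} (hy : ∀ i, ‖y i‖ ≤ τ) (hz : ∀ i, ‖z i‖ ≤ τ) {R : ℝ} (hR : ∑ i, ‖y i - z i‖ ≤ R)
    (hτ : 0 ≤ τ) (u : EuclideanSpace ℝ (Fin L)) :
    |∑ i, inner ℝ u (y i) ^ 2 - ∑ i, inner ℝ u (z i) ^ 2| ≤ 2 * τ * R * ‖u‖ ^ 2 := by
  rw [← Finset.sum_sub_distrib]
  calc _ ≤ ∑ i, 2 * τ * ‖u‖ ^ 2 * ‖y i - z i‖ := by
        refine (Finset.abs_sum_le_sum_abs _ _).trans (Finset.sum_le_sum fun i _ => ?_)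
        have e : inner ℝ u (y i) ^ 2 - inner ℝ u (z i) ^ 2 =
            inner ℝ u (y i + z i) * inner ℝ u (y i - z i) := by
          rw [inner_add_right, inner_sub_right]; ring
        have h1 : ‖y i + z i‖ ≤ 2 * τ := (norm_add_le _ _).trans (by linarith [hy i, hz i])
        rw [e, abs_mul]
        calc _ ≤ (‖u‖ * ‖y i + z i‖) * (‖u‖ * ‖y i - z i‖) := by
              gcongr <;> exact abs_real_inner_le_norm _ _
          _ ≤ (‖u‖ * (2 * τ)) * (‖u‖ * ‖y i - z i‖) := by gcongr
          _ = _ := by ring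
    _ = 2 * τ * ‖u‖ ^ 2 * ∑ i, ‖y i - z i‖ := by rw [Finset.mul_sum]
    _ ≤ 2 * τ * ‖u‖ ^ 2 * R := by gcongr
    _ = _ := by ring

lemma abs_sum_sq_inner_sub_quadratic_le {ι : Type*} [Fintype ι]
    {z : ι → EuclideanSpace ℝ (Fin L)} {A : Matrix (Fin L) (Fin L) ℝ} {η : ℝ}
    (h : ∀ j k, |∑ i, z i j * z i k - A j k| ≤ η) (u : EuclideanSpace ℝ (Fin L)) :
    |∑ i, inner ℝ u (z i) ^ 2 - inner ℝ u (Matrix.toEuclideanLin A u)| ≤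
      L ^ 2 * η * ‖u‖ ^ 2 := by
  have e : ∑ i, inner ℝ u (z i) ^ 2 - inner ℝ u (Matrix.toEuclideanLin A u) =
      ∑ j, ∑ k, u j * u k * (∑ i, z i j * z i k - A j k) := by
    simp only [inner_toEuclideanLin, mul_sub, Finset.sum_sub_distrib]
    congr 1
    simp only [Finset.mul_sum]
    rw [Finset.sum_congr rfl fun j _ => Finset.sum_comm, Finset.sum_comm]
    refine Finset.sum_congr rfl fun i _ => ?_
    rw [PiLp.inner_apply, sq, Finset.sum_mul_sum]
    simp only [RCLike.inner_apply, conj_trivial]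
    exact Finset.sum_congr rfl fun j _ => Finset.sum_congr rfl fun k _ => by ring
  rw [e]
  calc _ ≤ ∑ j : Fin L, ∑ k : Fin L, ‖u‖ * ‖u‖ * η := by
        refine (Finset.abs_sum_le_sum_abs _ _).trans (Finset.sum_le_sum fun j _ => ?_)
        refine (Finset.abs_sum_le_sum_abs _ _).trans (Finset.sum_le_sum fun k _ => ?_)
        rw [abs_mul, abs_mul]
        gcongr
        · exact abs_apply_le_norm u j
        · exact abs_apply_le_norm u k
        · exact h j k
    _ = _ := by simp; ring

end Coordinates

/-! ### Samples on which the expansion holds -/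

section Sample

variable {𝓓 : Type*} [MeasurableSpace 𝓓] {p L : ℕ}

/-- `f` is twice continuously differentiable on `U`, with its first two derivatives and `‖f‖³`
bounded by `C` there: the regularity condition on `g(d, ·)` for a single `d`. -/
structure DominatedOn (f : EuclideanSpace ℝ (Fin p) → EuclideanSpace ℝ (Fin L))
    (U : Set (EuclideanSpace ℝ (Fin p))) (C : ℝ) : Prop where
  contDiffOn : ContDiffOn ℝ 2 f U
  fderiv_le : ∀ γ ∈ U, ‖fderiv ℝ f γ‖ ≤ C
  iteratedFDeriv_le : ∀ γ ∈ U, ‖iteratedFDeriv ℝ 2 f γ‖ ≤ C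
  norm_pow_le : ∀ γ ∈ U, ‖f γ‖ ^ 3 ≤ C

/-- The properties of a sample and an estimate `γ` on which the expansion rests. The conditions with
`M` hold with probability close to one for large `M`, the ones with `η` with probability tending to
one for every `η`. -/
structure TypicalSample (P : Measure 𝓓)
    (g : 𝓓 → EuclideanSpace ℝ (Fin p) → EuclideanSpace ℝ (Fin L))
    (γ₀ : EuclideanSpace ℝ (Fin p)) (G : 𝓓 → ℝ) (M η : ℝ) {n : ℕ} (data : Fin n → 𝓓)
    (γ : EuclideanSpace ℝ (Fin p)) : Prop where
  estimate : ‖γ - γ₀‖ ≤ M / √n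
  score : ∀ j, |∑ i, g (data i) γ₀ j| ≤ M * √n
  dominating : ∑ i, G (data i) ≤ M * n
  jacobian : ∀ j k, |(n : ℝ)⁻¹ * ∑ i, (fderiv ℝ (g (data i)) γ₀ (EuclideanSpace.single k 1)) j
    - Sigma12 P g γ₀ j k| ≤ η
  second_moment : ∀ j k, |(n : ℝ)⁻¹ * ∑ i, g (data i) γ₀ j * g (data i) γ₀ k
    - Sigma11 P g γ₀ j k| ≤ η

variable {P : Measure 𝓓} {g : 𝓓 → EuclideanSpace ℝ (Fin p) → EuclideanSpace ℝ (Fin L)}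
  {γ₀ γ : EuclideanSpace ℝ (Fin p)} {G : 𝓓 → ℝ} {M η ρ : ℝ} {n : ℕ} {data : Fin n → 𝓓}
  {U : Set (EuclideanSpace ℝ (Fin p))}

lemma sum_norm_pow_three_le (hn : n ≠ 0) (hdom : ∀ i, DominatedOn (g (data i)) U (G (data i)))
    (h : TypicalSample P g γ₀ G M η data γ) (hγ : γ ∈ U) :
    ∑ i, ‖(√n)⁻¹ • g (data i) γ‖ ^ 3 ≤ M / √n := by
  have hs : 0 < √(n : ℝ) := Real.sqrt_pos.2 (by positivity)
  have hs2 : √(n : ℝ) ^ 2 = n := Real.sq_sqrt (by positivity)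
  calc _ ≤ ∑ i, (√(n : ℝ))⁻¹ ^ 3 * G (data i) := by
        refine Finset.sum_le_sum fun i _ => ?_
        rw [norm_smul, mul_pow, Real.norm_of_nonneg (by positivity)]
        gcongr
        exact (hdom i).norm_pow_le γ hγ
    _ = (√(n : ℝ))⁻¹ ^ 3 * ∑ i, G (data i) := by rw [Finset.mul_sum]
    _ ≤ (√(n : ℝ))⁻¹ ^ 3 * (M * √(n : ℝ) ^ 2) := by rw [hs2]; gcongr; exact h.dominating
    _ = _ := by field_simp

/-- `√n Q` as a Euclidean vector. -/
noncomputable def scaledQ (P : Measure 𝓓)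
    (g : 𝓓 → EuclideanSpace ℝ (Fin p) → EuclideanSpace ℝ (Fin L))
    (γ₀ : EuclideanSpace ℝ (Fin p)) {n : ℕ} (data : Fin n → 𝓓)
    (γ : EuclideanSpace ℝ (Fin p)) : EuclideanSpace ℝ (Fin L) :=
  WithLp.toLp 2 (√n • Qvec P g γ₀ data γ)

lemma norm_scaledQ_le (hn : n ≠ 0) (h : TypicalSample P g γ₀ G M η data γ) :
    ‖scaledQ P g γ₀ data γ‖ ≤ ∑ j, (M + ∑ k, |Sigma12 P g γ₀ j k| * M) := by
  have hs : 0 < √(n : ℝ) := Real.sqrt_pos.2 (by positivity)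
  refine (norm_le_sum_abs_apply _).trans (Finset.sum_le_sum fun j _ => ?_)
  have e : scaledQ P g γ₀ data γ j = (√n)⁻¹ * ∑ i, g (data i) γ₀ j +
      ∑ k, Sigma12 P g γ₀ j k * (√n * (γ k - γ₀ k)) := by
    simp only [scaledQ, Qvec, Pi.smul_apply, smul_eq_mul, Matrix.mulVec, dotProduct, mul_add,
      Finset.mul_sum]
    congr 1
    · refine Finset.sum_congr rfl fun i _ => ?_
      rw [← mul_assoc, ← div_eq_mul_inv, Real.sqrt_div_self]
    · exact Finset.sum_congr rfl fun k _ => by ring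
  rw [e]
  refine (abs_add_le _ _).trans (add_le_add ?_ ?_)
  · rw [abs_mul, abs_of_pos (inv_pos.2 hs), inv_mul_le_iff₀ hs, mul_comm]
    exact h.score j
  · refine (Finset.abs_sum_le_sum_abs _ _).trans (Finset.sum_le_sum fun k _ => ?_)
    rw [abs_mul, abs_mul, abs_of_pos hs]
    gcongr
    have h1 := (abs_apply_le_norm (γ - γ₀) k).trans h.estimate
    rw [le_div_iff₀ hs, mul_comm] at h1
    exact h1

/-- The sum of the scaled `g(Dᵢ, γ)` differs from `√n Q` by a Taylor remainder and by the
deviation of the sample Jacobian from `Σ₁₂`. -/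
lemma norm_sum_sub_scaledQ_le (hn : n ≠ 0) (hU : IsOpen U) (hρ : Metric.ball γ₀ ρ ⊆ U)
    (hdom : ∀ i, DominatedOn (g (data i)) U (G (data i)))
    (h : TypicalSample P g γ₀ G M η data γ) (hγ : γ ∈ Metric.ball γ₀ ρ) :
    ‖∑ i, (√n)⁻¹ • g (data i) γ - scaledQ P g γ₀ data γ‖ ≤ M ^ 3 / √n + L * p * η * M := by
  have hs : 0 < √(n : ℝ) := Real.sqrt_pos.2 (by positivity)
  have hs2 : √(n : ℝ) ^ 2 = n := Real.sq_sqrt (by positivity)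
  have hM : 0 ≤ M := by
    have := (norm_nonneg _).trans h.estimate
    rwa [le_div_iff₀ hs, zero_mul] at this
  have hG : ∀ i, 0 ≤ G (data i) := fun i =>
    (norm_nonneg _).trans ((hdom i).fderiv_le γ (hρ hγ))
  set R : EuclideanSpace ℝ (Fin L) := ∑ i, (√(n : ℝ))⁻¹ •
    (g (data i) γ - g (data i) γ₀ - fderiv ℝ (g (data i)) γ₀ (γ - γ₀)) with hRdef
  have hR : ‖R‖ ≤ M ^ 3 / √n := by
    calc ‖R‖ ≤ ∑ i, (√(n : ℝ))⁻¹ * (G (data i) * (M / √n) ^ 2) := by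
          refine (norm_sum_le _ _).trans (Finset.sum_le_sum fun i _ => ?_)
          rw [norm_smul, Real.norm_of_nonneg (by positivity)]
          gcongr
          refine (norm_sub_sub_fderiv_le_of_contDiffOn hU (hdom i).contDiffOn hρ
            (hdom i).iteratedFDeriv_le hγ).trans ?_
          gcongr
          · exact hG i
          · exact h.estimate
      _ = (√(n : ℝ))⁻¹ * (M / √n) ^ 2 * ∑ i, G (data i) := by
          rw [Finset.mul_sum]; exact Finset.sum_congr rfl fun i _ => by ring
      _ ≤ (√(n : ℝ))⁻¹ * (M / √n) ^ 2 * (M * √(n : ℝ) ^ 2) := by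
          rw [hs2]; gcongr; exact h.dominating
      _ = _ := by field_simp
  have hlin : ∀ i j, fderiv ℝ (g (data i)) γ₀ (γ - γ₀) j =
      ∑ k, (fderiv ℝ (g (data i)) γ₀ (EuclideanSpace.single k 1)) j * (γ k - γ₀ k) := by
    intro i j
    have e : γ - γ₀ = ∑ k, (γ k - γ₀ k) • EuclideanSpace.single k (1 : ℝ) := by
      ext m; simp [Pi.single_apply]
    conv_lhs => rw [e]
    simp [map_sum, mul_comm]
  have hD : ∀ j, (∑ i, (√(n : ℝ))⁻¹ • g (data i) γ - scaledQ P g γ₀ data γ - R) j =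
      ∑ k, ((n : ℝ)⁻¹ * ∑ i, (fderiv ℝ (g (data i)) γ₀ (EuclideanSpace.single k 1)) j
        - Sigma12 P g γ₀ j k) * (√n * (γ k - γ₀ k)) := by
    intro j
    have e1 : (∑ i, (√(n : ℝ))⁻¹ • g (data i) γ - scaledQ P g γ₀ data γ - R) j =
        (√(n : ℝ))⁻¹ * ∑ i, g (data i) γ₀ j
        + (√(n : ℝ))⁻¹ * ∑ i, fderiv ℝ (g (data i)) γ₀ (γ - γ₀) j
        - √n * ((n : ℝ)⁻¹ * ∑ i, g (data i) γ₀ j)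
        - √n * ∑ k, Sigma12 P g γ₀ j k * (γ k - γ₀ k) := by
      simp only [hRdef, scaledQ, Qvec, Matrix.mulVec, dotProduct, PiLp.sub_apply,
        WithLp.ofLp_sum, Finset.sum_apply, PiLp.smul_apply, Pi.smul_apply, smul_eq_mul,
        Finset.mul_sum, mul_sub, Finset.sum_sub_distrib, mul_add]
      ring
    have e2 : √(n : ℝ) * (n : ℝ)⁻¹ = (√n)⁻¹ := by
      rw [← div_eq_mul_inv, Real.sqrt_div_self]
    rw [e1, ← mul_assoc, e2]
    simp only [hlin, sub_mul, Finset.sum_sub_distrib]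
    rw [Finset.sum_comm]
    simp only [Finset.mul_sum, Finset.sum_mul]
    rw [← e2]
    rw [add_sub_right_comm, sub_self, zero_add]
    congr 1
    · exact Finset.sum_congr rfl fun k _ => Finset.sum_congr rfl fun i _ => by ring
    · exact Finset.sum_congr rfl fun k _ => by ring
  have hD' : ‖∑ i, (√(n : ℝ))⁻¹ • g (data i) γ - scaledQ P g γ₀ data γ - R‖ ≤ L * p * η * M := by
    calc _ ≤ ∑ j : Fin L, ∑ k : Fin p, η * M := by
          refine (norm_le_sum_abs_apply _).trans (Finset.sum_le_sum fun j _ => ?_)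
          rw [hD]
          refine (Finset.abs_sum_le_sum_abs _ _).trans (Finset.sum_le_sum fun k _ => ?_)
          rw [abs_mul, abs_mul, abs_of_pos hs]
          have h1 := (abs_apply_le_norm (γ - γ₀) k).trans h.estimate
          rw [le_div_iff₀ hs, mul_comm] at h1
          exact mul_le_mul (h.jacobian j k) h1 (by positivity) ((abs_nonneg _).trans
            (h.jacobian j k))
      _ = _ := by simp; ring
  calc _ = ‖(∑ i, (√(n : ℝ))⁻¹ • g (data i) γ - scaledQ P g γ₀ data γ - R) + R‖ := by
        rw [sub_add_cancel]
    _ ≤ _ := (norm_add_le _ _).trans (by linarith)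

lemma abs_sum_sq_inner_sub_Sigma11_le (hn : n ≠ 0) (hU : IsOpen U) (hρ : Metric.ball γ₀ ρ ⊆ U)
    (hdom : ∀ i, DominatedOn (g (data i)) U (G (data i)))
    (h : TypicalSample P g γ₀ G M η data γ) (hγ : γ ∈ Metric.ball γ₀ ρ) {τ : ℝ} (hτ : 0 ≤ τ)
    (hMτ : M / √n ≤ τ ^ 3) (u : EuclideanSpace ℝ (Fin L)) :
    |∑ i, inner ℝ u ((√n)⁻¹ • g (data i) γ) ^ 2 -
      inner ℝ u (Matrix.toEuclideanLin (Sigma11 P g γ₀) u)| ≤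
      (2 * τ * M ^ 2 + L ^ 2 * η) * ‖u‖ ^ 2 := by
  have hs : 0 < √(n : ℝ) := Real.sqrt_pos.2 (by positivity)
  have hs2 : √(n : ℝ) ^ 2 = n := Real.sq_sqrt (by positivity)
  have hM : 0 ≤ M := by
    have := (norm_nonneg _).trans h.estimate
    rwa [le_div_iff₀ hs, zero_mul] at this
  have hγ₀ : γ₀ ∈ Metric.ball γ₀ ρ := Metric.mem_ball_self (dist_nonneg.trans_lt hγ)
  have hG : ∀ i, 0 ≤ G (data i) := fun i =>
    (norm_nonneg _).trans ((hdom i).fderiv_le γ (hρ hγ))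
  have hsmall : ∀ γ' ∈ U, ∀ i, ‖(√(n : ℝ))⁻¹ • g (data i) γ'‖ ≤ τ := fun γ' hγ' i => by
    refine le_of_pow_le_pow_left₀ three_ne_zero hτ ((le_trans ?_ hMτ))
    rw [norm_smul, mul_pow, Real.norm_of_nonneg (by positivity)]
    calc _ ≤ (√(n : ℝ))⁻¹ ^ 3 * ∑ i, G (data i) := by
          gcongr
          exact ((hdom i).norm_pow_le γ' hγ').trans
            (Finset.single_le_sum (f := fun i => G (data i)) (fun i _ => hG i) (Finset.mem_univ i))
      _ ≤ (√(n : ℝ))⁻¹ ^ 3 * (M * √(n : ℝ) ^ 2) := by rw [hs2]; gcongr; exact h.dominating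
      _ = _ := by field_simp
  have hdiff : ∑ i, ‖(√(n : ℝ))⁻¹ • g (data i) γ - (√(n : ℝ))⁻¹ • g (data i) γ₀‖ ≤ M ^ 2 := by
    calc _ ≤ ∑ i, (√(n : ℝ))⁻¹ * (G (data i) * (M / √n)) := by
          refine Finset.sum_le_sum fun i _ => ?_
          rw [← smul_sub, norm_smul, Real.norm_of_nonneg (by positivity)]
          gcongr
          refine (norm_sub_le_of_contDiffOn hU (hdom i).contDiffOn hρ
            (hdom i).fderiv_le hγ).trans ?_
          gcongr
          · exact hG i
          · exact h.estimate
      _ = (√(n : ℝ))⁻¹ * (M / √n) * ∑ i, G (data i) := by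
          rw [Finset.mul_sum]; exact Finset.sum_congr rfl fun i _ => by ring
      _ ≤ (√(n : ℝ))⁻¹ * (M / √n) * (M * √(n : ℝ) ^ 2) := by
          rw [hs2]; gcongr; exact h.dominating
      _ = _ := by field_simp
  have h1 := abs_sum_sq_inner_sub_le (hsmall γ (hρ hγ)) (hsmall γ₀ (hρ hγ₀)) hdiff hτ u
  have h2 := abs_sum_sq_inner_sub_quadratic_le (z := fun i => (√(n : ℝ))⁻¹ • g (data i) γ₀)
    (A := Sigma11 P g γ₀) (η := η) (fun j k => by
      refine le_of_eq_of_le ?_ (h.second_moment j k)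
      congr 2
      rw [Finset.mul_sum]
      refine Finset.sum_congr rfl fun i _ => ?_
      simp only [PiLp.smul_apply, smul_eq_mul]
      rw [mul_mul_mul_comm, ← mul_inv, Real.mul_self_sqrt (by positivity)]) u
  refine (abs_sub_le _ _ _).trans ((add_le_add h1 h2).trans (le_of_eq (by ring)))

/-- On typical samples the multiplier exists, is unique and gives the empirical likelihood, and the
quadratic expansion holds up to `ε`. -/
lemma expansion_of_typicalSample (hpd : (Sigma11 P g γ₀).PosDef) (hU : IsOpen U) (hγ₀ : γ₀ ∈ U)
    (G : 𝓓 → ℝ) (M : ℝ) {ε : ℝ} (hε : 0 < ε) :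
    ∃ η : ℝ, 0 < η ∧ ∀ᶠ n : ℕ in atTop, ∀ (data : Fin n → 𝓓) (γ : EuclideanSpace ℝ (Fin p)),
      (∀ i, DominatedOn (g (data i)) U (G (data i))) → TypicalSample P g γ₀ G M η data γ →
      ∃ lam, IsLagrangeMultiplier (fun i => g (data i) γ) lam ∧
        (∀ lam', IsLagrangeMultiplier (fun i => g (data i) γ) lam' → lam' = lam) ∧
        negLogEmpLik (fun i => g (data i) γ) = (logSum (fun i => g (data i) γ) lam : ℝ) ∧
        |logSum (fun i => g (data i) γ) lam - (1 / 2 : ℝ) * ((√n • Qvec P g γ₀ data γ) ⬝ᵥ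
          ((Sigma11 P g γ₀)⁻¹ *ᵥ (√n • Qvec P g γ₀ data γ)))| < ε := by
  obtain ⟨ρ, hρ0, hρ⟩ := Metric.isOpen_iff.1 hU γ₀ hγ₀
  obtain ⟨c, hc, hcoer⟩ := hpd.exists_coercive
  have hsymm : (Matrix.toEuclideanLin (Sigma11 P g γ₀)).IsSymmetric :=
    Matrix.isSymmetric_toEuclideanLin_iff.2 hpd.isHermitian
  obtain ⟨M', hM'⟩ : ∃ M', M' = ∑ j, (|M| + ∑ k, |Sigma12 P g γ₀ j k| * |M|) := ⟨_, rfl⟩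
  have hM'0 : 0 ≤ M' := by rw [hM']; positivity
  obtain ⟨κ, hκ, hcrit⟩ := exists_critical_point hsymm hc hcoer hM'0 hε
  -- The error bounds below are of the form `C / √n + C' η` and `C τ + C' η`.
  obtain ⟨η, hη, hη1⟩ : ∃ η : ℝ, 0 < η ∧ (L * p * |M| + L ^ 2) * η ≤ κ / 2 := by
    refine ⟨κ / 2 / (L * p * |M| + L ^ 2 + 1), by positivity, ?_⟩
    rw [← mul_div_assoc, div_le_iff₀ (by positivity)]
    nlinarith
  obtain ⟨τ, hτ, hτ1⟩ : ∃ τ : ℝ, 0 < τ ∧ 2 * τ * M ^ 2 ≤ κ / 2 := by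
    refine ⟨κ / 4 / (M ^ 2 + 1), by positivity, ?_⟩
    rw [mul_div_assoc', div_mul_eq_mul_div, div_le_iff₀ (by positivity)]
    nlinarith
  have htend : ∀ C : ℝ, Tendsto (fun n : ℕ => C / √(n : ℝ)) atTop (𝓝 0) := fun C =>
    tendsto_const_nhds.div_atTop (Real.tendsto_sqrt_atTop.comp tendsto_natCast_atTop_atTop)
  refine ⟨η, hη, ?_⟩
  filter_upwards [(htend M).eventually (gt_mem_nhds hρ0),
    (htend M).eventually (ge_mem_nhds hκ),
    (htend M).eventually (ge_mem_nhds (show (0 : ℝ) < τ ^ 3 by positivity)),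
    (htend (M ^ 3)).eventually (ge_mem_nhds (half_pos hκ)), eventually_ne_atTop 0]
    with n hnρ hn1 hn2 hn3 hn data γ hdom h
  have hs : 0 < √(n : ℝ) := Real.sqrt_pos.2 (by positivity)
  have hM : 0 ≤ M := by
    have := (norm_nonneg _).trans h.estimate
    rwa [le_div_iff₀ hs, zero_mul] at this
  rw [abs_of_nonneg hM] at hη1 hM'
  have hγ : γ ∈ Metric.ball γ₀ ρ := by
    rw [Metric.mem_ball, dist_eq_norm]; exact h.estimate.trans_lt hnρ
  have hη2 : 0 ≤ (L * p * M) * η := by positivity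
  have hη3 : 0 ≤ (L : ℝ) ^ 2 * η := by positivity
  obtain ⟨w, hwdef⟩ : ∃ w : EuclideanSpace ℝ (Fin L), w = WithLp.toLp 2
    ((Sigma11 P g γ₀)⁻¹ *ᵥ (√n • Qvec P g γ₀ data γ)) := ⟨_, rfl⟩
  have hw : Matrix.toEuclideanLin (Sigma11 P g γ₀) w = scaledQ P g γ₀ data γ := by
    rw [Matrix.toLpLin_apply, hwdef, scaledQ, Matrix.mulVec_mulVec,
      Matrix.mul_nonsing_inv _ ((Matrix.isUnit_iff_isUnit_det _).1 hpd.isUnit), Matrix.one_mulVec]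
  obtain ⟨hspan, v, hvpos, hvsum, hvlog⟩ := hcrit (fun i => (√(n : ℝ))⁻¹ • g (data i) γ)
    (scaledQ P g γ₀ data γ) w hw (hM' ▸ norm_scaledQ_le hn h)
    ((sum_norm_pow_three_le hn hdom h (hρ hγ)).trans hn1)
    ((norm_sum_sub_scaledQ_le hn hU hρ hdom h hγ).trans (by linarith))
    (fun u => (abs_sum_sq_inner_sub_Sigma11_le hn hU hρ hdom h hγ hτ.le hn2 u).trans (by
      gcongr; linarith))
  have hinner : ∀ x : EuclideanSpace ℝ (Fin L),
      inner ℝ ((√(n : ℝ))⁻¹ • v) x = inner ℝ v ((√(n : ℝ))⁻¹ • x) := fun x => by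
    rw [real_inner_smul_left, real_inner_smul_right]
  have hlam : IsLagrangeMultiplier (fun i => g (data i) γ) ((√(n : ℝ))⁻¹ • v) := by
    refine ⟨fun i => by rw [hinner]; exact hvpos i, ?_⟩
    simp only [hinner]
    simp only [smul_comm _ ((√(n : ℝ))⁻¹)] at hvsum
    rw [← Finset.smul_sum] at hvsum
    rw [(smul_eq_zero.1 hvsum).resolve_left (inv_ne_zero hs.ne'), smul_zero]
  refine ⟨_, hlam, fun lam' h' => hlam.unique hn (fun u hu => hspan u fun i => ?_) h',
    hlam.negLogEmpLik_eq hn, ?_⟩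
  · rw [real_inner_smul_right, hu i, mul_zero]
  · have e1 : logSum (fun i => g (data i) γ) ((√(n : ℝ))⁻¹ • v) =
        logSum (fun i => (√(n : ℝ))⁻¹ • g (data i) γ) v := by simp only [logSum, hinner]
    have e2 : inner ℝ (scaledQ P g γ₀ data γ) w = (√n • Qvec P g γ₀ data γ) ⬝ᵥ
          ((Sigma11 P g γ₀)⁻¹ *ᵥ (√n • Qvec P g γ₀ data γ)) := by
      rw [PiLp.inner_apply, hwdef, scaledQ, dotProduct]
      exact Finset.sum_congr rfl fun j _ => by
        simp only [RCLike.inner_apply, conj_trivial]; ring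
    rw [e1, ← e2, one_div_mul_eq_div]
    exact hvlog

end Sample

/-! ### Limit theorems for sums over the sample -/

section Limit

variable {Ω 𝓓 : Type*} [MeasurableSpace Ω] [MeasurableSpace 𝓓] {μ : Measure Ω}
  {P : Measure 𝓓} {D : ℕ → Ω → 𝓓}

lemma aestronglyMeasurable_comp_of_hasLaw (hlaw : ∀ i, HasLaw (D i) P μ) {f : 𝓓 → ℝ}
    (hf : AEStronglyMeasurable f P) (i : ℕ) : AEStronglyMeasurable (fun ω => f (D i ω)) μ :=
  AEStronglyMeasurable.comp_aemeasurable (by rwa [(hlaw i).map_eq]) (hlaw i).aemeasurable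

lemma pairwise_indepFun_comp_of_hasLaw (hlaw : ∀ i, HasLaw (D i) P μ) (hindep : iIndepFun D μ)
    {f : 𝓓 → ℝ} (hf : AEStronglyMeasurable f P) :
    Pairwise (Function.onFun (IndepFun · · μ) fun i ω => f (D i ω)) := fun i j hij =>
  (hindep.comp₀ (fun _ => f) (fun i => (hlaw i).aemeasurable)
    (fun i => by rw [(hlaw i).map_eq]; exact hf.aemeasurable)).indepFun hij

lemma identDistrib_comp_of_hasLaw (hlaw : ∀ i, HasLaw (D i) P μ) {f : 𝓓 → ℝ}
    (hf : AEStronglyMeasurable f P) (i j : ℕ) :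
    IdentDistrib (fun ω => f (D i ω)) (fun ω => f (D j ω)) μ μ :=
  ((hlaw i).identDistrib (hlaw j)).comp_of_aemeasurable
    (by rw [(hlaw i).map_eq]; exact hf.aemeasurable)

/-- The weak law of large numbers for `f(Dᵢ)`. -/
lemma tendsto_measure_average [IsProbabilityMeasure μ] (hlaw : ∀ i, HasLaw (D i) P μ)
    (hindep : iIndepFun D μ)
    {f : 𝓓 → ℝ} (hf : Integrable f P) {η : ℝ} (hη : 0 < η) :
    Tendsto (fun n : ℕ => μ {ω | ¬ |(n : ℝ)⁻¹ * ∑ i : Fin n, f (D i ω) - ∫ d, f d ∂P| ≤ η})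
      atTop (𝓝 0) := by
  have hm := aestronglyMeasurable_comp_of_hasLaw hlaw hf.1
  have hint : Integrable (fun ω => f (D 0 ω)) μ :=
    Integrable.comp_aemeasurable (by rwa [(hlaw 0).map_eq]) (hlaw 0).aemeasurable
  have hlln := strong_law_ae_real (fun i ω => f (D i ω)) hint
    (pairwise_indepFun_comp_of_hasLaw hlaw hindep hf.1)
    (fun i => identDistrib_comp_of_hasLaw hlaw hf.1 i 0)
  have hmean : ∫ ω, f (D 0 ω) ∂μ = ∫ d, f d ∂P := (hlaw 0).integral_comp hf.1
  have hprob := tendstoInMeasure_of_tendsto_ae (fun n => by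
    simp only [div_eq_mul_inv]
    exact (Finset.aestronglyMeasurable_fun_sum _ fun i _ => hm i).mul_const _) hlln
  rw [tendstoInMeasure_iff_norm] at hprob
  refine tendsto_of_tendsto_of_tendsto_of_le_of_le tendsto_const_nhds (hprob η hη)
    (fun _ => zero_le) fun n => measure_mono fun ω hω => ?_
  simp only [Set.mem_ofPred_eq, not_le] at hω ⊢
  rw [hmean, Real.norm_eq_abs, ← Fin.sum_univ_eq_sum_range (fun i => f (D i ω)), div_eq_inv_mul]
  exact hω.le

/-- Sums of `n` centred variables `f(Dᵢ)` are `O_p(√n)`, by Chebyshev's inequality. -/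
lemma exists_measure_sum_le [IsProbabilityMeasure μ] (hlaw : ∀ i, HasLaw (D i) P μ)
    (hindep : iIndepFun D μ)
    {f : 𝓓 → ℝ} (hf : MemLp f 2 P) (hf0 : ∫ d, f d ∂P = 0) {ε : ℝ≥0∞} (hε : 0 < ε) :
    ∃ M : ℝ, ∀ n : ℕ, n ≠ 0 → μ {ω | ¬ |∑ i : Fin n, f (D i ω)| ≤ M * √n} ≤ ε := by
  obtain ⟨v, hvdef⟩ : ∃ v, v = Var[fun ω => f (D 0 ω); μ] := ⟨_, rfl⟩
  obtain ⟨M, hM0, hM⟩ : ∃ M : ℝ, 0 < M ∧ ENNReal.ofReal (v / M ^ 2) ≤ ε := by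
    have ht : Tendsto (fun M : ℝ => ENNReal.ofReal (v / M ^ 2)) atTop (𝓝 0) := by
      rw [← ENNReal.ofReal_zero]
      exact ENNReal.tendsto_ofReal (tendsto_const_nhds.div_atTop
        (tendsto_pow_atTop two_ne_zero))
    exact ((eventually_gt_atTop 0).and (ht.eventually (ge_mem_nhds hε))).exists
  refine ⟨M, fun n hn => ?_⟩
  have hmem : ∀ i, MemLp (fun ω => f (D i ω)) 2 μ := fun i =>
    MemLp.comp_of_map (g := f) (by rwa [(hlaw i).map_eq]) (hlaw i).aemeasurable
  have hs : 0 < √(n : ℝ) := Real.sqrt_pos.2 (by positivity)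
  have hvar : Var[∑ i ∈ Finset.range n, fun ω => f (D i ω); μ] = n * v := by
    rw [IndepFun.variance_sum (fun i _ => hmem i)
      ((pairwise_indepFun_comp_of_hasLaw hlaw hindep hf.1).set_pairwise _),
      Finset.sum_congr rfl fun i _ => (identDistrib_comp_of_hasLaw hlaw hf.1 i 0).variance_eq,
      Finset.sum_const, Finset.card_range, nsmul_eq_mul, hvdef]
  have hmean : ∫ ω, (∑ i ∈ Finset.range n, fun ω => f (D i ω)) ω ∂μ = 0 := by
    simp only [Finset.sum_apply]
    rw [integral_finsetSum _ fun i _ => (hmem i).integrable one_le_two]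
    refine Finset.sum_eq_zero fun i _ => ?_
    exact ((hlaw i).integral_comp hf.1).trans hf0
  have hcheb := meas_ge_le_variance_div_sq
    (memLp_finsetSum' (Finset.range n) fun i _ => hmem i) (mul_pos hM0 hs)
  rw [hmean, hvar, mul_pow, Real.sq_sqrt (by positivity), mul_comm (M ^ 2),
    mul_div_mul_left _ _ (by positivity)] at hcheb
  refine (measure_mono fun ω hω => ?_).trans (hcheb.trans hM)
  simp only [Set.mem_ofPred_eq, not_le, Finset.sum_apply, sub_zero] at hω ⊢
  rw [← Fin.sum_univ_eq_sum_range (fun i => f (D i ω))]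
  exact hω.le

end Limit

/-! ### Integrability under the regularity condition -/

section Integrability

variable {𝓓 : Type*} [MeasurableSpace 𝓓] {P : Measure 𝓓} {p L : ℕ}
  {g : 𝓓 → EuclideanSpace ℝ (Fin p) → EuclideanSpace ℝ (Fin L)} {γ₀ : EuclideanSpace ℝ (Fin p)}
  {G : 𝓓 → ℝ} {U : Set (EuclideanSpace ℝ (Fin p))}

lemma Regularity.exists_dominatedOn (h : Regularity P g γ₀) :
    ∃ U : Set (EuclideanSpace ℝ (Fin p)), IsOpen U ∧ γ₀ ∈ U ∧
      ∃ G : 𝓓 → ℝ, Integrable G P ∧ ∀ᵐ d ∂P, DominatedOn (g d) U (G d) := by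
  obtain ⟨U, hU, hγ₀, hsm, G, hG, hdom⟩ := h.smooth_dominated
  refine ⟨U, hU, hγ₀, G, hG, ?_⟩
  filter_upwards [hsm, hdom] with d h1 h2
  exact ⟨h1, fun γ hγ => (h2 γ hγ).1, fun γ hγ => (h2 γ hγ).2.1, fun γ hγ => (h2 γ hγ).2.2⟩

lemma integrable_mul_apply [IsFiniteMeasure P] (hm : Measurable fun d => g d γ₀) (hγ₀ : γ₀ ∈ U)
    (hG : Integrable G P) (hdom : ∀ᵐ d ∂P, DominatedOn (g d) U (G d)) (j k : Fin L) :
    Integrable (fun d => g d γ₀ j * g d γ₀ k) P := by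
  have hmj : ∀ j, Measurable fun d => g d γ₀ j := fun j => by fun_prop
  refine ((integrable_const (1 : ℝ)).add hG).mono' ((hmj j).mul (hmj k)).aestronglyMeasurable ?_
  filter_upwards [hdom] with d hd
  have h3 := hd.norm_pow_le γ₀ hγ₀
  have h0 := norm_nonneg (g d γ₀)
  rw [norm_mul]
  calc _ ≤ ‖g d γ₀‖ * ‖g d γ₀‖ := by
        gcongr <;> exact PiLp.norm_apply_le _ _
    _ ≤ 1 + ‖g d γ₀‖ ^ 3 := by
        nlinarith [mul_nonneg (sq_nonneg (‖g d γ₀‖ - 1)) (by linarith : 0 ≤ ‖g d γ₀‖ + 1)]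
    _ ≤ _ := by simpa using h3

lemma memLp_apply [IsFiniteMeasure P] (hm : Measurable fun d => g d γ₀) (hγ₀ : γ₀ ∈ U)
    (hG : Integrable G P) (hdom : ∀ᵐ d ∂P, DominatedOn (g d) U (G d)) (j : Fin L) :
    MemLp (fun d => g d γ₀ j) 2 P := by
  have hmj : Measurable fun d => g d γ₀ j := by fun_prop
  rw [memLp_two_iff_integrable_sq hmj.aestronglyMeasurable]
  simpa only [sq] using integrable_mul_apply hm hγ₀ hG hdom j j

lemma integral_apply_eq_zero (h0 : ∫ d, g d γ₀ ∂P = 0)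
    (hint : ∀ j, Integrable (fun d => g d γ₀ j) P) (j : Fin L) : ∫ d, g d γ₀ j ∂P = 0 := by
  have hi : Integrable (fun d => g d γ₀) P := Integrable.of_eval_piLp hint
  have := (EuclideanSpace.proj (𝕜 := ℝ) j).integral_comp_comm hi
  rw [h0, map_zero] at this
  exact this

/-- The Jacobian is measurable in the datum as an almost sure limit of difference quotients. -/
lemma integrable_fderiv_apply (hm : ∀ γ, Measurable fun d => g d γ) (hU : IsOpen U) (hγ₀ : γ₀ ∈ U)
    (hG : Integrable G P) (hdom : ∀ᵐ d ∂P, DominatedOn (g d) U (G d)) (j : Fin L) (k : Fin p) :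
    Integrable (fun d => (fderiv ℝ (g d) γ₀ (EuclideanSpace.single k 1)) j) P := by
  have hmeas : AEStronglyMeasurable (fun d => fderiv ℝ (g d) γ₀ (EuclideanSpace.single k 1)) P := by
    refine aestronglyMeasurable_of_tendsto_ae atTop (f := fun (m : ℕ) d =>
      (m : ℝ) • (g d (γ₀ + (m : ℝ)⁻¹ • EuclideanSpace.single k 1) - g d γ₀))
      (fun m => Measurable.aestronglyMeasurable <| by
        have h1 := hm (γ₀ + (m : ℝ)⁻¹ • EuclideanSpace.single k 1)
        have h2 := hm γ₀
        fun_prop) ?_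
    filter_upwards [hdom] with d hd
    refine ((hd.contDiffOn.contDiffAt (hU.mem_nhds hγ₀)).differentiableAt
      (by norm_num)).hasFDerivAt.lim _ ?_
    simpa using tendsto_natCast_atTop_atTop (R := ℝ)
  refine hG.mono' ((EuclideanSpace.proj (𝕜 := ℝ) j).continuous.comp_aestronglyMeasurable hmeas) ?_
  filter_upwards [hdom] with d hd
  calc _ ≤ ‖fderiv ℝ (g d) γ₀ (EuclideanSpace.single k 1)‖ := PiLp.norm_apply_le _ _
    _ ≤ ‖fderiv ℝ (g d) γ₀‖ * ‖EuclideanSpace.single k (1 : ℝ)‖ := ContinuousLinearMap.le_opNorm _ _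
    _ ≤ G d := by simpa using hd.fderiv_le γ₀ hγ₀

end Integrability

/-! ### Typical samples have probability close to one -/

section Typical

variable {Ω : Type*} [MeasurableSpace Ω] {μ : Measure Ω}

lemma tendsto_measure_not_forall {ι : Type*} [Fintype ι] {Q : ι → ℕ → Ω → Prop}
    (h : ∀ i, Tendsto (fun n => μ {ω | ¬ Q i n ω}) atTop (𝓝 0)) :
    Tendsto (fun n => μ {ω | ¬ ∀ i, Q i n ω}) atTop (𝓝 0) := by
  have hsum : Tendsto (fun n => ∑ i, μ {ω | ¬ Q i n ω}) atTop (𝓝 0) := by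
    simpa using tendsto_finsetSum Finset.univ fun i _ => h i
  refine tendsto_of_tendsto_of_tendsto_of_le_of_le tendsto_const_nhds hsum
    (fun _ => zero_le) fun n => ?_
  refine (measure_mono fun ω hω => ?_).trans (measure_iUnion_fintype_le μ _)
  simpa using hω

variable {𝓓 : Type*} [MeasurableSpace 𝓓] [IsProbabilityMeasure μ] {P : Measure 𝓓} {p L : ℕ}
  {D : ℕ → Ω → 𝓓} {g : 𝓓 → EuclideanSpace ℝ (Fin p) → EuclideanSpace ℝ (Fin L)}
  {γ₀ : EuclideanSpace ℝ (Fin p)} {γhat : ℕ → Ω → EuclideanSpace ℝ (Fin p)}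
  {G : 𝓓 → ℝ} {U : Set (EuclideanSpace ℝ (Fin p))}

lemma exists_measure_forall_sum_le (hlaw : ∀ i, HasLaw (D i) P μ) (hindep : iIndepFun D μ)
    {f : Fin L → 𝓓 → ℝ} (hf : ∀ j, MemLp (f j) 2 P) (hf0 : ∀ j, ∫ d, f j d ∂P = 0)
    {ε : ℝ≥0∞} (hε : 0 < ε) :
    ∃ M : ℝ, ∀ n : ℕ, n ≠ 0 → μ {ω | ¬ ∀ j, |∑ i : Fin n, f j (D i ω)| ≤ M * √n} ≤ ε := by
  have hε' : 0 < ε / (L + 1 : ℕ) := ENNReal.div_pos hε.ne' (ENNReal.natCast_ne_top _)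
  choose M hM using fun j => exists_measure_sum_le hlaw hindep (hf j) (hf0 j) hε'
  refine ⟨∑ j, |M j|, fun n hn => ?_⟩
  calc _ ≤ μ (⋃ j, {ω | ¬ |∑ i : Fin n, f j (D i ω)| ≤ M j * √n}) := by
        refine measure_mono fun ω hω => ?_
        simp only [Set.mem_ofPred_eq, not_forall, Set.mem_iUnion] at hω ⊢
        obtain ⟨j, hj⟩ := hω
        refine ⟨j, fun h => hj (h.trans ?_)⟩
        gcongr
        exact (le_abs_self _).trans
          (Finset.single_le_sum (f := fun j => |M j|) (fun _ _ => abs_nonneg _) (Finset.mem_univ j))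
    _ ≤ ∑ j, μ {ω | ¬ |∑ i : Fin n, f j (D i ω)| ≤ M j * √n} := measure_iUnion_fintype_le μ _
    _ ≤ ∑ _j : Fin L, ε / (L + 1 : ℕ) := Finset.sum_le_sum fun j _ => hM j n hn
    _ ≤ (L + 1 : ℕ) * (ε / (L + 1 : ℕ)) := by
        rw [Finset.sum_const, Finset.card_univ, Fintype.card_fin, nsmul_eq_mul]
        gcongr
        exact Nat.le_succ L
    _ ≤ ε := ENNReal.mul_div_le

lemma exists_measure_not_typicalSample_le (hlaw : ∀ i, HasLaw (D i) P μ) (hindep : iIndepFun D μ)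
    (hreg : Regularity P g γ₀)
    (hγ : IsBigOInProb μ (fun n ω => γhat n ω - γ₀) (fun n => (Real.sqrt n)⁻¹))
    (hU : IsOpen U) (hγ₀ : γ₀ ∈ U)
    (hG : Integrable G P) (hdom : ∀ᵐ d ∂P, DominatedOn (g d) U (G d)) {ε : ℝ≥0∞} (hε : 0 < ε) :
    ∃ M : ℝ, ∀ η : ℝ, 0 < η → ∀ᶠ n : ℕ in atTop,
      μ {ω | ¬ TypicalSample P g γ₀ G M η (fun i : Fin n => D i ω) (γhat n ω)} ≤ ε := by
  have hP : IsProbabilityMeasure P := (hlaw 0).isProbabilityMeasure_iff.1 inferInstance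
  have hε3 : 0 < ε / 3 := ENNReal.div_pos hε.ne' (by norm_num)
  have hL2 := memLp_apply (hreg.measurable γ₀) hγ₀ hG hdom
  obtain ⟨M₁, hM₁⟩ := hγ _ hε3
  obtain ⟨M₂, hM₂⟩ := exists_measure_forall_sum_le hlaw hindep hL2
    (integral_apply_eq_zero hreg.mean_zero fun j => (hL2 j).integrable one_le_two) hε3
  refine ⟨max (max M₁ M₂) (∫ d, G d ∂P + 1), fun η hη => ?_⟩
  have h3 := tendsto_measure_average hlaw hindep hG one_pos
  have h4 := tendsto_measure_not_forall fun jk : Fin L × Fin p =>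
    tendsto_measure_average hlaw hindep
      (integrable_fderiv_apply hreg.measurable hU hγ₀ hG hdom jk.1 jk.2) hη
  have h5 := tendsto_measure_not_forall fun jk : Fin L × Fin L =>
    tendsto_measure_average hlaw hindep
      (integrable_mul_apply (hreg.measurable γ₀) hγ₀ hG hdom jk.1 jk.2) hη
  have h345 := (h3.add h4).add h5
  rw [add_zero, add_zero] at h345
  filter_upwards [hM₁, h345.eventually (ge_mem_nhds hε3), eventually_ne_atTop 0]
    with n hn1 hn345 hn
  have hn0 : (0 : ℝ) < n := by positivity
  have hsub : {ω | ¬ TypicalSample P g γ₀ G (max (max M₁ M₂) (∫ d, G d ∂P + 1)) η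
      (fun i : Fin n => D i ω) (γhat n ω)} ⊆
      {ω | M₁ * (√n)⁻¹ < ‖γhat n ω - γ₀‖} ∪
      {ω | ¬ ∀ j, |∑ i : Fin n, g (D i ω) γ₀ j| ≤ M₂ * √n} ∪
      ({ω | ¬ |(n : ℝ)⁻¹ * ∑ i : Fin n, G (D i ω) - ∫ d, G d ∂P| ≤ 1} ∪
      {ω | ¬ ∀ jk : Fin L × Fin p, |(n : ℝ)⁻¹ * ∑ i : Fin n,
        (fderiv ℝ (g (D i ω)) γ₀ (EuclideanSpace.single jk.2 1)) jk.1 -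
        ∫ d, (fderiv ℝ (g d) γ₀ (EuclideanSpace.single jk.2 1)) jk.1 ∂P| ≤ η} ∪
      {ω | ¬ ∀ jk : Fin L × Fin L, |(n : ℝ)⁻¹ * ∑ i : Fin n,
        g (D i ω) γ₀ jk.1 * g (D i ω) γ₀ jk.2 -
        ∫ d, g d γ₀ jk.1 * g d γ₀ jk.2 ∂P| ≤ η}) := by
    intro ω hω
    by_contra hcon
    simp only [Set.mem_union, Set.mem_ofPred_eq, not_or, not_not, not_lt] at hcon
    obtain ⟨⟨c1, c2⟩, ⟨c3, c4⟩, c5⟩ := hcon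
    refine hω ⟨?_, fun j => ?_, ?_, fun j k => c4 (j, k), fun j k => c5 (j, k)⟩
    · rw [div_eq_mul_inv]
      exact c1.trans (by gcongr; exact (le_max_left _ _).trans (le_max_left _ _))
    · exact (c2 j).trans (by gcongr; exact (le_max_right _ _).trans (le_max_left _ _))
    · have h := (abs_le.1 c3).2
      have h' : (n : ℝ)⁻¹ * ∑ i : Fin n, G (D i ω) ≤ ∫ d, G d ∂P + 1 := by linarith
      rw [inv_mul_le_iff₀ hn0, mul_comm] at h'
      exact h'.trans (by gcongr; exact le_max_right _ _)
  calc _ ≤ _ := measure_mono hsub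
    _ ≤ ε / 3 + ε / 3 + ε / 3 := by
        refine (measure_union_le _ _).trans (add_le_add ?_ ?_)
        · exact (measure_union_le _ _).trans (add_le_add hn1 (hM₂ n hn))
        · refine (measure_union_le _ _).trans (le_trans ?_ hn345)
          gcongr
          exact measure_union_le _ _
    _ = ε := ENNReal.add_thirds ε

/-- With probability tending to one the multiplier exists, is unique and gives the empirical
likelihood, and the quadratic expansion holds up to `δ`. -/
lemma tendsto_measure_not_expansion (hlaw : ∀ i, HasLaw (D i) P μ) (hindep : iIndepFun D μ)
    (hreg : Regularity P g γ₀)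
    (hγ : IsBigOInProb μ (fun n ω => γhat n ω - γ₀) (fun n => (Real.sqrt n)⁻¹))
    {δ : ℝ} (hδ : 0 < δ) :
    Tendsto (fun n : ℕ => μ {ω | ¬ ∃ lam : EuclideanSpace ℝ (Fin L),
        IsLagrangeMultiplier (fun i : Fin n => g (D i ω) (γhat n ω)) lam ∧
        (∀ lam', IsLagrangeMultiplier (fun i : Fin n => g (D i ω) (γhat n ω)) lam' →
          lam' = lam) ∧
        negLogEmpLik (fun i : Fin n => g (D i ω) (γhat n ω)) =
          (logSum (fun i : Fin n => g (D i ω) (γhat n ω)) lam : ℝ) ∧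
        |logSum (fun i : Fin n => g (D i ω) (γhat n ω)) lam - (1 / 2 : ℝ) *
          ((√n • Qvec P g γ₀ (fun i : Fin n => D i ω) (γhat n ω)) ⬝ᵥ ((Sigma11 P g γ₀)⁻¹ *ᵥ
            (√n • Qvec P g γ₀ (fun i : Fin n => D i ω) (γhat n ω))))| < δ}) atTop (𝓝 0) := by
  obtain ⟨U, hU, hγ₀, G, hG, hdom⟩ := hreg.exists_dominatedOn
  refine ENNReal.tendsto_nhds_zero.2 fun ε hε => ?_
  obtain ⟨M, hM⟩ := exists_measure_not_typicalSample_le hlaw hindep hreg hγ hU hγ₀ hG hdom hε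
  obtain ⟨η, hη, hexp⟩ := expansion_of_typicalSample hreg.posDef hU hγ₀ G M hδ
  have hae : ∀ᵐ ω ∂μ, ∀ i, DominatedOn (g (D i ω)) U (G (D i ω)) := ae_all_iff.2 fun i =>
    ae_of_ae_map (hlaw i).aemeasurable (by rwa [(hlaw i).map_eq])
  filter_upwards [hM η hη, hexp] with n hn1 hn2
  refine (measure_mono_ae ?_).trans hn1
  filter_upwards [hae] with ω hω hbad htyp
  exact hbad (hn2 _ _ (fun i => hω i) htyp)

end Typical

theorem theorem2 {Ω 𝓓 : Type*} [MeasurableSpace Ω] [MeasurableSpace 𝓓]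
    (μ : Measure Ω) [IsProbabilityMeasure μ] (P : Measure 𝓓) {p L : ℕ}
    (D : ℕ → Ω → 𝓓) (hlaw : ∀ i, HasLaw (D i) P μ) (hindep : iIndepFun D μ)
    (g : 𝓓 → EuclideanSpace ℝ (Fin p) → EuclideanSpace ℝ (Fin L))
    (γ₀ : EuclideanSpace ℝ (Fin p)) (hreg : Regularity P g γ₀)
    (γhat : ℕ → Ω → EuclideanSpace ℝ (Fin p)) (hγm : ∀ n, AEMeasurable (γhat n) μ)
    (hγ : IsBigOInProb μ (fun n ω => γhat n ω - γ₀) (fun n => (Real.sqrt n)⁻¹)) :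
    -- with probability tending to one, the Lagrange multiplier exists, is unique,
    -- and represents the negative log empirical likelihood ratio
    Tendsto (fun n : ℕ => μ {ω | ¬ ∃ lam : EuclideanSpace ℝ (Fin L),
        IsLagrangeMultiplier (fun i : Fin n => g (D i ω) (γhat n ω)) lam ∧
        (∀ lam', IsLagrangeMultiplier (fun i : Fin n => g (D i ω) (γhat n ω)) lam' →
          lam' = lam) ∧
        negLogEmpLik (fun i : Fin n => g (D i ω) (γhat n ω)) =
          ((∑ i : Fin n, Real.log (1 + inner ℝ lam (g (D i ω) (γhat n ω))) : ℝ) : EReal)})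
      atTop (𝓝 0) ∧
    -- the quadratic expansion
    IsLittleOOneInProb μ (fun n ω =>
      negLogEmpLik (fun i : Fin n => g (D i ω) (γhat n ω)) -
        (((1 / 2 : ℝ) *
          ((Real.sqrt n • Qvec P g γ₀ (fun i : Fin n => D i ω) (γhat n ω)) ⬝ᵥ
            ((Sigma11 P g γ₀)⁻¹ *ᵥ
              (Real.sqrt n • Qvec P g γ₀ (fun i : Fin n => D i ω) (γhat n ω)))) : ℝ) :
          EReal)) := by
  refine ⟨?_, fun ε hε => ?_⟩
  · refine tendsto_of_tendsto_of_tendsto_of_le_of_le tendsto_const_nhds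
      (tendsto_measure_not_expansion hlaw hindep hreg hγ one_pos) (fun _ => zero_le)
      fun n => measure_mono fun ω hω ⟨lam, h1, h2, h3, _⟩ => hω ⟨lam, h1, h2, h3⟩
  · refine tendsto_of_tendsto_of_tendsto_of_le_of_le tendsto_const_nhds
      (tendsto_measure_not_expansion hlaw hindep hreg hγ hε) (fun _ => zero_le)
      fun n => measure_mono fun ω hω ⟨lam, _, _, h3, h4⟩ => ?_
    simp only [Set.mem_ofPred_eq] at hω
    rw [h3, ← EReal.coe_sub, EReal.abs_def, ENNReal.ofReal_le_ofReal_iff (abs_nonneg _)] at hω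
    exact absurd h4 hω.not_gt
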